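/- Let $S$ be a solenoid, that is, a space homeomorphic to the inverse limit of a sequence of unit circles $\mathbb{S}^1$ with bonding maps $z\mapsto z^{n_i}$, where $n_i\ge 2$ are integers, and let $K$ be a Knaster continuum, that is, a space homeomorphic to the inverse limit of a sequence of unit intervals $[0,1]$ with continuous open bonding maps. Then $K\times S$ has the fupcon property (full projections imply connected open neighborhoods): for every continuum (nonempty compact connected subset) $M\subseteq K\times S$ with $\pi_K(M)=K$ and $\pi_S(M)=S$, and every open set $U\subseteq K\times S$ with $M\subseteq U$, there exists an open connected set $V$ with $M\subseteq V\subseteq U$. -/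

import Mathlib

/-- The inverse limit of a sequence of spaces `X 0 ← X 1 ← X 2 ← ⋯` with bonding maps
`f i : X (i + 1) → X i`, as a subspace of the product. -/
def InverseLimit (X : ℕ → Type*) (f : ∀ i, X (i + 1) → X i) : Type _ :=
  {x : ∀ i, X i // ∀ i, f i (x (i + 1)) = x i}

instance (X : ℕ → Type*) [∀ i, TopologicalSpace (X i)] (f : ∀ i, X (i + 1) → X i) :
    TopologicalSpace (InverseLimit X f) :=
  instTopologicalSpaceSubtype

/-- A solenoid: a space homeomorphic to the inverse limit of a sequence of unit circles with
bonding maps `z ↦ z ^ n i`, where every `n i` is at least `2`. -/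
def IsSolenoid (S : Type*) [TopologicalSpace S] : Prop :=
  ∃ n : ℕ → ℕ, (∀ i, 2 ≤ n i) ∧
    Nonempty (S ≃ₜ InverseLimit (fun _ => Circle) (fun i z => z ^ n i))

/-- A Knaster continuum: a space homeomorphic to the inverse limit of a sequence of unit
intervals with continuous open bonding maps. (Such maps are automatically surjective.) -/
def IsKnasterContinuum (K : Type*) [TopologicalSpace K] : Prop :=
  ∃ f : ℕ → unitInterval → unitInterval, (∀ i, Continuous (f i)) ∧ (∀ i, IsOpenMap (f i)) ∧
    Nonempty (K ≃ₜ InverseLimit (fun _ => unitInterval) f)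

/-- `M` has arbitrarily small connected open neighbourhoods. -/
def HasSmallConnectedOpenNhds {Z : Type*} [TopologicalSpace Z] (M : Set Z) : Prop :=
  ∀ U : Set Z, IsOpen U → M ⊆ U → ∃ V : Set Z, IsOpen V ∧ IsConnected V ∧ M ⊆ V ∧ V ⊆ U

/-- The product `X × Y` has the fupcon property (full projections imply connected open
neighbourhoods): every subcontinuum (nonempty compact connected subset) `M` of `X × Y` that
projects onto both factors has arbitrarily small connected open neighbourhoods. -/
def ProdHasFupcon (X Y : Type*) [TopologicalSpace X] [TopologicalSpace Y] : Prop :=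
  ∀ M : Set (X × Y), IsCompact M → IsConnected M →
    Prod.fst '' M = Set.univ → Prod.snd '' M = Set.univ → HasSmallConnectedOpenNhds M

/-!
Present `K × S` as the inverse limit of annuli `I × Circle` with bonding maps `f i × (z ↦ z ^ n i)`
and coordinate maps `P i`. By compactness some `P i ⁻¹' W`, with `W` a connected open
neighbourhood of `P i '' M`, lies in the given neighbourhood `U` of `M`. It is shown that
`P i ⁻¹' W` is connected.

Let `L = P j '' M`, and let `F` be the bonding map from stage `j` to stage `i`. The key point
(`isPreconnected_preimage_of_isEssential`) is that `F ⁻¹' W` is connected. This is planar topology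
in the universal covering `I × ℝ` of the annulus, where `F` becomes `f × (t ↦ N t)`, an open proper
map:

* `W` winds around the annulus (`IsEssential`). Otherwise there is a continuous branch `θ` of the
  angle on `W` (`exists_angle_of_not_isEssential`), and on `M` the circle coordinates at later
  stages are constant multiples of `exp (θ / N)` with `N` arbitrarily large. As `θ` is bounded on `M`, they
  could not be onto, contrary to `M` projecting onto `S`
  (`eventually_image_ne_univ_of_pow_eq_exp`).
* Open proper maps send components of preimages onto components, so every component of `F ⁻¹' W`
  also winds around the annulus.
* As `M` projects onto `K`, the connected set `L ⊆ F ⁻¹' W` joins the two boundary circles. A path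
  joining the two edges of the strip meets every path running far enough in both directions along it
  (`exists_eq_of_crossing`), so every component of `F ⁻¹' W` is the one containing `L`.

Connectedness is passed to the limit by `isPreconnected_of_forall_image`: a separation of a closed
set is visible at a finite stage.
-/

open Set Topology
open scoped unitInterval

/-! ### Crossing paths in the plane -/

/-- A connected set of angles on which `sin (· - c)` is nonnegative stays in the interval
`[c, c + π]` as soon as it meets it. -/
theorem subset_Icc_of_sin_sub_nonneg {s : Set ℝ} (hs : IsPreconnected s) {c x₀ : ℝ}
    (hsin : ∀ x ∈ s, 0 ≤ Real.sin (x - c)) (hx₀ : x₀ ∈ s) (hx₀c : x₀ ∈ Icc c (c + Real.pi)) :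
    s ⊆ Icc c (c + Real.pi) := by
  have hpi := Real.pi_pos
  intro y hy
  obtain ⟨h1, h2⟩ := hx₀c
  constructor
  · by_contra! h
    have hv : max y (c - Real.pi / 2) ∈ s :=
      hs.ordConnected.out hy hx₀ ⟨le_max_left _ _, max_le (by linarith) (by linarith)⟩
    have := hsin _ hv
    have h3 : max y (c - Real.pi / 2) < c := max_lt h (by linarith)
    have h4 := le_max_right y (c - Real.pi / 2)
    linarith [Real.sin_neg_of_neg_of_neg_pi_lt (x := max y (c - Real.pi / 2) - c)
      (by linarith) (by linarith)]
  · by_contra! h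
    have hv : min y (c + 3 * Real.pi / 2) ∈ s :=
      hs.ordConnected.out hx₀ hy ⟨le_min (by linarith) (by linarith), min_le_left _ _⟩
    have h3 : c + Real.pi < min y (c + 3 * Real.pi / 2) := lt_min h (by linarith)
    have h4 := min_le_right y (c + 3 * Real.pi / 2)
    have h5 := Real.sin_neg_of_neg_of_neg_pi_lt (x := min y (c + 3 * Real.pi / 2) - c - 2 * Real.pi)
      (by linarith) (by linarith)
    rw [Real.sin_sub_two_pi] at h5
    linarith [hsin _ hv]

/-- A path crossing from left to right and a path crossing from bottom to top meet. Otherwise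
`α s - β t` is a nowhere vanishing function on the square and has a continuous logarithm. On each
side of the square this difference lies in a fixed half-plane, which confines its angle to an
interval of length `π`; going around the square, the angle would have to turn by `2π`. -/
theorem exists_eq_of_crossing {α β : I → ℝ × ℝ} (hα : Continuous α) (hβ : Continuous β)
    (hleft : ∀ t, (α 0).1 ≤ (β t).1) (hright : ∀ t, (β t).1 ≤ (α 1).1)
    (hbot : ∀ s, (β 0).2 ≤ (α s).2) (htop : ∀ s, (α s).2 ≤ (β 1).2) :
    ∃ s t, α s = β t := by
  by_contra! hne
  let F : C(I × I, ℂ) :=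
    ⟨fun p => Complex.equivRealProdCLM.symm (α p.1 - β p.2), by fun_prop⟩
  have hFre : ∀ p, (F p).re = (α p.1).1 - (β p.2).1 := fun p => by
    simp [F, Complex.equivRealProdCLM_symm_apply]
  have hFim : ∀ p, (F p).im = (α p.1).2 - (β p.2).2 := fun p => by
    simp [F, Complex.equivRealProdCLM_symm_apply]
  have hF0 : ∀ p, F p ∈ ({0}ᶜ : Set ℂ) := fun p => by
    simpa [F, sub_eq_zero] using hne p.1 p.2
  have : LocallyPathConnectedSpace I := (convex_Icc (0 : ℝ) 1).locallyPathConnectedSpace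
  have : ContractibleSpace I := (convex_Icc (0 : ℝ) 1).contractibleSpace ⟨0, by simp⟩
  obtain ⟨g, ⟨hg0, hg⟩, -⟩ := Complex.isCoveringMapOn_exp.existsUnique_continuousMap_lifts F
    (a₀ := (0, 0)) (Complex.exp_log (hF0 (0, 0))) hF0
  have hgF : ∀ p, Complex.exp (g p) = F p := fun p => congrFun hg p
  have hre : ∀ p, (F p).re = Real.exp (g p).re * Real.cos (g p).im := fun p => by
    rw [← hgF, Complex.exp_re]
  have him : ∀ p, (F p).im = Real.exp (g p).re * Real.sin (g p).im := fun p => by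
    rw [← hgF, Complex.exp_im]
  have hcos : ∀ p, 0 ≤ (F p).re → 0 ≤ Real.cos (g p).im := fun p h => by
    rw [hre] at h; exact nonneg_of_mul_nonneg_right h (Real.exp_pos _)
  have hcos' : ∀ p, (F p).re ≤ 0 → Real.cos (g p).im ≤ 0 := fun p h => by
    rw [hre] at h; exact nonpos_of_mul_nonpos_right h (Real.exp_pos _)
  have hsin : ∀ p, 0 ≤ (F p).im → 0 ≤ Real.sin (g p).im := fun p h => by
    rw [him] at h; exact nonneg_of_mul_nonneg_right h (Real.exp_pos _)
  have hsin' : ∀ p, (F p).im ≤ 0 → Real.sin (g p).im ≤ 0 := fun p h => by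
    rw [him] at h; exact nonpos_of_mul_nonpos_right h (Real.exp_pos _)
  have side : ∀ (e : I → I × I), Continuous e → IsPreconnected (range fun u => (g (e u)).im) :=
    fun e he => isPreconnected_range (by fun_prop)
  have hpi := Real.pi_pos
  -- The lift starts at the principal logarithm, so the angle at `(0, 0)` is the principal one.
  have b00 : (g (0, 0)).im ∈ Icc (Real.pi / 2) Real.pi := by
    have h1 : 0 ≤ (g (0, 0)).im := by
      rw [hg0, Complex.log_im, Complex.arg_nonneg_iff, hFim]
      exact sub_nonneg.2 (hbot 0)
    have h2 : (g (0, 0)).im ≤ Real.pi := by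
      rw [hg0, Complex.log_im]; exact Complex.arg_le_pi _
    refine ⟨?_, h2⟩
    by_contra! h
    have := hcos' (0, 0) (by rw [hFre]; exact sub_nonpos.2 (hleft 0))
    linarith [Real.cos_pos_of_mem_Ioo (x := (g (0, 0)).im) ⟨by linarith, h⟩]
  -- The angle is followed from the corner `(0, 0)`: once up the side `s = 0`, and once along the
  -- three other sides. The two intervals obtained for the corner `(0, 1)` are disjoint.
  have sL := subset_Icc_of_sin_sub_nonneg (c := Real.pi / 2) (side (fun u => (0, u)) (by fun_prop))
    (by
      rintro _ ⟨u, rfl⟩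
      rw [Real.sin_sub_pi_div_two]
      linarith [hcos' (0, u) (by rw [hFre]; exact sub_nonpos.2 (hleft u))])
    ⟨0, rfl⟩ ⟨b00.1, by linarith [b00.2]⟩
  have sB := subset_Icc_of_sin_sub_nonneg (c := 0) (side (fun u => (u, 0)) (by fun_prop))
    (by
      rintro _ ⟨u, rfl⟩
      rw [sub_zero]
      exact hsin (u, 0) (by rw [hFim]; exact sub_nonneg.2 (hbot u)))
    ⟨0, rfl⟩ ⟨by linarith [b00.1], by linarith [b00.2]⟩
  have b10 := sB ⟨1, rfl⟩
  have c10 := hcos (1, 0) (by rw [hFre]; exact sub_nonneg.2 (hright 0))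
  have b10' : (g (1, 0)).im ≤ Real.pi / 2 := by
    by_contra! h
    linarith [Real.cos_neg_of_pi_div_two_lt_of_lt (x := (g (1, 0)).im) h (by linarith [b10.2])]
  have sR := subset_Icc_of_sin_sub_nonneg (c := -(Real.pi / 2))
    (side (fun u => (1, u)) (by fun_prop))
    (by
      rintro _ ⟨u, rfl⟩
      rw [sub_neg_eq_add, Real.sin_add_pi_div_two]
      exact hcos (1, u) (by rw [hFre]; exact sub_nonneg.2 (hright u)))
    ⟨0, rfl⟩ ⟨by linarith [b10.1], by linarith [b10']⟩
  have b11 := sR ⟨1, rfl⟩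
  have c11 := hsin' (1, 1) (by rw [hFim]; exact sub_nonpos.2 (htop 1))
  have b11' : (g (1, 1)).im ≤ 0 := by
    by_contra! h
    linarith [Real.sin_pos_of_pos_of_lt_pi (x := (g (1, 1)).im) h (by linarith [b11.2])]
  have sT := subset_Icc_of_sin_sub_nonneg (c := -Real.pi) (side (fun u => (u, 1)) (by fun_prop))
    (by
      rintro _ ⟨u, rfl⟩
      rw [sub_neg_eq_add, Real.sin_add_pi]
      linarith [hsin' (u, 1) (by rw [hFim]; exact sub_nonpos.2 (htop u))])
    ⟨1, rfl⟩ ⟨by linarith [b11.1], by linarith [b11']⟩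
  have b01 := sT ⟨0, rfl⟩
  have b01' := sL ⟨1, rfl⟩
  simp only [mem_Icc] at b01 b01'
  linarith [b01.2, b01'.1]

/-! ### Components of preimages -/

theorem isOpenMap_circleExp : IsOpenMap Circle.exp := Circle.isCoveringMap_exp.isOpenMap

theorem closure_inter_subset_connectedComponentIn {X : Type*} [TopologicalSpace X] {s : Set X}
    {x : X} (hx : x ∈ s) :
    closure (connectedComponentIn s x) ∩ s ⊆ connectedComponentIn s x := by
  refine IsPreconnected.subset_connectedComponentIn (x := x) ?_
    ⟨subset_closure (mem_connectedComponentIn hx), hx⟩ inter_subset_right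
  exact isPreconnected_connectedComponentIn.subset_closure
    (subset_inter subset_closure (connectedComponentIn_subset s x)) inter_subset_left

/-- Under an open and closed map, every component of the preimage of a connected open set `D`
covers `D`: its image is both open and closed in `D`. -/
theorem image_connectedComponentIn_of_isOpenMap_of_isClosedMap {X Y : Type*} [TopologicalSpace X]
    [TopologicalSpace Y] [LocallyConnectedSpace X] {φ : X → Y} (hφ : Continuous φ)
    (hopen : IsOpenMap φ) (hclosed : IsClosedMap φ) {D : Set Y} (hDo : IsOpen D)
    (hD : IsPreconnected D) {x : X} (hx : φ x ∈ D) :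
    φ '' connectedComponentIn (φ ⁻¹' D) x = D := by
  set E := connectedComponentIn (φ ⁻¹' D) x with hE
  have hED : E ⊆ φ ⁻¹' D := connectedComponentIn_subset _ _
  have hxE : x ∈ E := mem_connectedComponentIn hx
  refine subset_antisymm (image_subset_iff.2 hED) ?_
  refine hD.subset_left_of_subset_union (hopen _ (hDo.preimage hφ).connectedComponentIn)
    (v := (φ '' closure E)ᶜ) (hclosed _ isClosed_closure).isOpen_compl ?_ ?_
    ⟨φ x, hx, mem_image_of_mem _ hxE⟩
  · exact disjoint_compl_right_iff_subset.2 (image_mono subset_closure)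
  · intro y hy
    by_cases h : y ∈ φ '' closure E
    · obtain ⟨z, hz, rfl⟩ := h
      exact Or.inl ⟨z, closure_inter_subset_connectedComponentIn (s := φ ⁻¹' D) hx ⟨hz, hy⟩, rfl⟩
    · exact Or.inr h

/-! ### The universal covering of the annulus -/

instance : LocallyPathConnectedSpace I := (convex_Icc (0 : ℝ) 1).locallyPathConnectedSpace

/-- The universal covering of the annulus `I × Circle` by the strip `I × ℝ`. -/
noncomputable def annulusCover : I × ℝ → I × Circle := Prod.map id Circle.exp

theorem continuous_annulusCover : Continuous annulusCover :=
  continuous_id.prodMap Circle.exp.continuous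

theorem isOpenMap_annulusCover : IsOpenMap annulusCover :=
  IsOpenMap.id.prodMap isOpenMap_circleExp

theorem annulusCover_surjective : Function.Surjective annulusCover :=
  Function.surjective_id.prodMap Circle.exp_surjective

theorem annulusCover_shift (a : I × ℝ) (k : ℤ) :
    annulusCover (a.1, a.2 + k * (2 * Real.pi)) = annulusCover a := by
  simp only [annulusCover, Prod.map, Prod.mk.injEq, true_and, id]
  exact Circle.exp_eq_exp.2 ⟨k, rfl⟩

theorem annulusCover_eq_iff {a b : I × ℝ} :
    annulusCover a = annulusCover b ↔ ∃ k : ℤ, a = (b.1, b.2 + k * (2 * Real.pi)) := by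
  refine ⟨fun h => ?_, ?_⟩
  · obtain ⟨k, hk⟩ := Circle.exp_eq_exp.1 (congrArg Prod.snd h)
    exact ⟨k, Prod.ext (Prod.ext_iff.1 h).1 hk⟩
  · rintro ⟨k, rfl⟩
    exact annulusCover_shift b k

instance : LocallyPathConnectedSpace (I × Circle) :=
  (isOpenMap_annulusCover.isQuotientMap continuous_annulusCover
    annulusCover_surjective).locallyPathConnectedSpace

/-- A deck transformation carrying some point of the component of `a` into the component of `x`
also carries `a` there. -/
theorem shift_mem_connectedComponentIn {W : Set (I × Circle)} {x a b : I × ℝ} (k : ℤ)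
    (hb : b ∈ connectedComponentIn (annulusCover ⁻¹' W) a)
    (h : (b.1, b.2 + k * (2 * Real.pi)) ∈ connectedComponentIn (annulusCover ⁻¹' W) x) :
    (a.1, a.2 + k * (2 * Real.pi)) ∈ connectedComponentIn (annulusCover ⁻¹' W) x := by
  have ha : a ∈ annulusCover ⁻¹' W := connectedComponentIn_nonempty_iff.1 ⟨b, hb⟩
  let τ : I × ℝ → I × ℝ := fun a => (a.1, a.2 + k * (2 * Real.pi))
  have hτ : Continuous τ := by fun_prop
  rw [connectedComponentIn_eq h]
  refine (isPreconnected_connectedComponentIn.image τ hτ.continuousOn).subset_connectedComponentIn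
    (mem_image_of_mem τ hb) ?_ (mem_image_of_mem τ (mem_connectedComponentIn ha))
  rintro _ ⟨c, hc, rfl⟩
  have hcW : annulusCover c ∈ W := connectedComponentIn_subset (annulusCover ⁻¹' W) a hc
  rwa [← annulusCover_shift c k] at hcW

/-- Every component of the preimage in the strip of a connected open set `W` covers `W`. The
components are permuted by the deck transformations, so their images, which are open, are either
equal or disjoint. -/
theorem annulusCover_image_connectedComponentIn {W : Set (I × Circle)} (hWo : IsOpen W)
    (hW : IsPreconnected W) {x : I × ℝ} (hx : annulusCover x ∈ W) :
    annulusCover '' connectedComponentIn (annulusCover ⁻¹' W) x = W := by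
  set E := connectedComponentIn (annulusCover ⁻¹' W) x with hE
  have hopen : ∀ y, IsOpen (annulusCover '' connectedComponentIn (annulusCover ⁻¹' W) y) :=
    fun y => isOpenMap_annulusCover _
      (hWo.preimage continuous_annulusCover).connectedComponentIn
  refine subset_antisymm (image_subset_iff.2 (connectedComponentIn_subset _ _)) ?_
  -- The union of the images of the components that are not translates of `E`.
  let O : Set (I × Circle) := ⋃ y ∈ {y | annulusCover y ∈ W ∧ annulusCover y ∉ annulusCover '' E},
    annulusCover '' connectedComponentIn (annulusCover ⁻¹' W) y
  refine hW.subset_left_of_subset_union (hopen x) (isOpen_biUnion fun y _ => hopen y)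
    (v := O) ?_ ?_ ⟨annulusCover x, hx, mem_image_of_mem _ (mem_connectedComponentIn hx)⟩
  · rw [Set.disjoint_left]
    rintro _ ⟨e, he, rfl⟩ hO
    simp only [O, mem_iUnion] at hO
    obtain ⟨y, ⟨-, hy⟩, b, hb, hbe⟩ := hO
    obtain ⟨k, rfl⟩ := annulusCover_eq_iff.1 hbe.symm
    exact hy ⟨_, shift_mem_connectedComponentIn k hb he, annulusCover_shift y k⟩
  · intro w hw
    obtain ⟨y, rfl⟩ := annulusCover_surjective w
    by_cases h : annulusCover y ∈ annulusCover '' E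
    · exact Or.inl h
    · exact Or.inr (mem_biUnion (x := y) ⟨hw, h⟩
        (mem_image_of_mem _ (mem_connectedComponentIn hw)))

/-! ### Essential subsets of the annulus -/

/-- A subset of the annulus is essential if all components of its preimage in the strip are
unbounded in both directions. For connected open sets this says that the set contains a loop that
winds around the annulus; the definition through components avoids choosing such a loop. -/
def IsEssential (W : Set (I × Circle)) : Prop :=
  ∀ x, annulusCover x ∈ W → ∀ R : ℝ,
    (∃ y ∈ connectedComponentIn (annulusCover ⁻¹' W) x, R ≤ y.2) ∧
    ∃ y ∈ connectedComponentIn (annulusCover ⁻¹' W) x, y.2 ≤ R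

theorem iterate_shift_mem {D : Set (I × ℝ)} {c : ℝ} (h : ∀ a ∈ D, (a.1, a.2 + c) ∈ D)
    {a : I × ℝ} (ha : a ∈ D) (n : ℕ) : (a.1, a.2 + n * c) ∈ D := by
  induction n with
  | zero => simpa using ha
  | succ n ih =>
    convert h _ ih using 2
    push_cast
    ring

theorem unbounded_of_shift_mem {D : Set (I × ℝ)} (hD : D.Nonempty) {c : ℝ} (hc : 0 < c)
    (h : ∀ a ∈ D, (a.1, a.2 + c) ∈ D) (h' : ∀ a ∈ D, (a.1, a.2 + -c) ∈ D) (R : ℝ) :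
    (∃ y ∈ D, R ≤ y.2) ∧ ∃ y ∈ D, y.2 ≤ R := by
  obtain ⟨a, ha⟩ := hD
  obtain ⟨n, hn⟩ := exists_nat_ge (|R - a.2| / c)
  rw [div_le_iff₀ hc, abs_le] at hn
  exact ⟨⟨_, iterate_shift_mem h ha n, by simp only; linarith⟩,
    ⟨_, iterate_shift_mem h' ha n, by simp only; linarith⟩⟩

/-- An open connected set which is not essential carries a continuous branch of the angle: a
component of its preimage that is not unbounded in both directions is disjoint from its other
translates, so it is mapped homeomorphically onto the set. -/
theorem exists_angle_of_not_isEssential {W : Set (I × Circle)} (hWo : IsOpen W)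
    (hW : IsPreconnected W) (h : ¬ IsEssential W) :
    ∃ θ : I × Circle → ℝ, ContinuousOn θ W ∧ ∀ w ∈ W, Circle.exp (θ w) = w.2 := by
  simp only [IsEssential, not_forall] at h
  obtain ⟨x, hx, R, hR⟩ := h
  set D := connectedComponentIn (annulusCover ⁻¹' W) x with hD
  have hDo : IsOpen D := (hWo.preimage continuous_annulusCover).connectedComponentIn
  have hshift : ∀ (k : ℤ) (d : I × ℝ), d ∈ D → (d.1, d.2 + k * (2 * Real.pi)) ∈ D →
      ∀ a ∈ D, (a.1, a.2 + k * (2 * Real.pi)) ∈ D := fun k d hd hdk a ha =>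
    shift_mem_connectedComponentIn k (connectedComponentIn_eq ha ▸ hd) hdk
  have hpos : ∀ (k : ℤ) (d : I × ℝ), 0 < k → d ∈ D → (d.1, d.2 + k * (2 * Real.pi)) ∉ D := by
    intro k d hk hd hdk
    refine hR (unbounded_of_shift_mem ⟨d, hd⟩ (c := k * (2 * Real.pi))
      (by have := Real.pi_pos; positivity) (hshift k d hd hdk) ?_ R)
    have := hshift (-k) _ hdk (by simpa using hd)
    simpa using this
  have hinj : InjOn annulusCover D := by
    intro a ha b hb hab
    obtain ⟨k, rfl⟩ := annulusCover_eq_iff.1 hab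
    rcases lt_trichotomy k 0 with hk | hk | hk
    · exact absurd (by simpa using hb) (hpos (-k) _ (by omega) ha)
    · simp [hk]
    · exact absurd ha (hpos k b hk hb)
  have himg : annulusCover '' D = W := annulusCover_image_connectedComponentIn hWo hW hx
  have : Nonempty (I × ℝ) := ⟨x⟩
  refine ⟨fun w => (Function.invFunOn annulusCover D w).2, ?_, ?_⟩
  · refine continuous_snd.comp_continuousOn ?_
    intro w hw
    have hw' : w ∈ annulusCover '' D := himg.symm ▸ hw
    intro N hN
    obtain ⟨O, hON, hO, hwO⟩ := mem_nhds_iff.1 hN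
    refine mem_nhdsWithin_of_mem_nhds (Filter.mem_of_superset
      ((isOpenMap_annulusCover _ (hDo.inter hO)).mem_nhds
        ⟨_, ⟨Function.invFunOn_mem hw', hwO⟩, Function.invFunOn_eq hw'⟩) ?_)
    rintro _ ⟨d, ⟨hd, hdO⟩, rfl⟩
    rw [mem_preimage, hinj.leftInvOn_invFunOn hd]
    exact hON hdO
  · intro w hw
    have hw' : w ∈ annulusCover '' D := himg.symm ▸ hw
    exact congrArg Prod.snd (Function.invFunOn_eq hw')

/-- If `exp θ` has an `N`-th root `v` on a continuum `M`, then `v` is a constant multiple of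
`exp (θ / N)`, as the ratio takes values in the finite set of `N`-th roots of unity. As `θ` is
bounded, `v` is not onto the circle when `N` is large. -/
theorem eventually_image_ne_univ_of_pow_eq_exp {Z : Type*} [TopologicalSpace Z] {M : Set Z}
    (hMc : IsCompact M) (hM : IsPreconnected M) {θ : Z → ℝ} (hθ : ContinuousOn θ M) :
    ∀ᶠ N : ℕ in Filter.atTop, ∀ v : Z → Circle, ContinuousOn v M →
      (∀ m ∈ M, v m ^ N = Circle.exp (θ m)) → v '' M ≠ univ := by
  obtain ⟨B, hB⟩ := hMc.exists_bound_of_continuousOn hθ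
  obtain ⟨N₀, hN₀⟩ := exists_nat_gt (B / Real.pi)
  filter_upwards [Filter.eventually_ge_atTop (max N₀ 1)] with N hN v hv hvN hsurj
  have hN1 : 0 < N := (le_max_right _ _).trans hN
  have hNR : (0 : ℝ) < N := by exact_mod_cast hN1
  have hBN : B / N < Real.pi := by
    rw [div_lt_iff₀ Real.pi_pos] at hN₀
    rw [div_lt_iff₀ hNR]
    have : (N₀ : ℝ) ≤ N := by exact_mod_cast (le_max_left _ _).trans hN
    nlinarith [Real.pi_pos]
  let r : Z → Circle := fun m => v m * (Circle.exp (θ m / N))⁻¹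
  have hr : ContinuousOn r M :=
    hv.mul (Circle.exp.continuous.comp_continuousOn (hθ.div_const _)).inv
  have hroot : r '' M ⊆ {z : Circle | z ^ N = 1} := by
    rintro _ ⟨m, hm, rfl⟩
    have h1 : Circle.exp (θ m / N) ^ N = Circle.exp (θ m) := by
      rw [← Circle.exp_natCast_mul]
      congr 1
      field_simp
    simp [r, mul_pow, hvN m hm, h1]
  have hfin : {z : Circle | z ^ N = 1}.Finite := by
    have : {z : ℂ | z ^ N = 1}.Finite := by
      have : NeZero N := ⟨hN1.ne'⟩
      refine (Polynomial.nthRootsFinset N (1 : ℂ)).finite_toSet.subset fun z hz => ?_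
      simpa [Polynomial.mem_nthRootsFinset hN1] using hz
    refine this.preimage (f := ((↑) : Circle → ℂ)) Circle.coe_injective.injOn |>.subset ?_
    intro z hz
    exact congrArg ((↑) : Circle → ℂ) hz
  have hsub : (r '' M).Subsingleton := by
    rw [← not_nontrivial_iff]
    exact fun h => (hM.image r hr).infinite_of_nontrivial h (hfin.subset hroot)
  -- The point opposite to `r m₀` is not a value of `v`, because `|θ / N| < π`.
  obtain ⟨m₀, hm₀, -⟩ : (1 : Circle) ∈ v '' M := hsurj ▸ mem_univ _
  obtain ⟨m, hm, hvm⟩ : Circle.exp Real.pi * r m₀ ∈ v '' M := hsurj ▸ mem_univ _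
  have hrm : r m = r m₀ := hsub (mem_image_of_mem r hm) (mem_image_of_mem r hm₀)
  have hvr : v m = Circle.exp (θ m / N) * r m := by simp [r]
  rw [hvr, hrm] at hvm
  have h2 : |θ m / N| < Real.pi := by
    rw [abs_div, abs_of_pos hNR]
    exact lt_of_le_of_lt (by gcongr; exact hB m hm) hBN
  rw [abs_lt] at h2
  have h3 := congrArg (fun z : Circle => Complex.arg z) (mul_right_cancel hvm)
  simp only [Circle.arg_exp h2.1 h2.2.le, Circle.arg_exp (by linarith [Real.pi_pos]) le_rfl] at h3
  linarith [h2.2]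

/-! ### Connected preimages under bonding maps -/

theorem exists_continuous_path_of_isPreconnected {X : Type*} [TopologicalSpace X]
    [LocallyPathConnectedSpace X] {E : Set X} (hEo : IsOpen E) (hE : IsPreconnected E) {a b : X}
    (ha : a ∈ E) (hb : b ∈ E) :
    ∃ γ : I → X, Continuous γ ∧ γ 0 = a ∧ γ 1 = b ∧ ∀ t, γ t ∈ E := by
  obtain ⟨γ, hγ⟩ := (hEo.isConnected_iff_isPathConnected.1 ⟨⟨a, ha⟩, hE⟩).joinedIn a ha b hb
  exact ⟨γ, γ.continuous, γ.source, γ.target, hγ⟩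

theorem inter_nonempty_of_spanning_of_unbounded {E G : Set (I × ℝ)} (hEo : IsOpen E)
    (hE : IsPreconnected E) (hGo : IsOpen G) (hG : IsPreconnected G)
    (hup : ∀ R : ℝ, ∃ y ∈ E, R ≤ y.2) (hdown : ∀ R : ℝ, ∃ y ∈ E, y.2 ≤ R)
    (h0 : ∃ a ∈ G, a.1 = 0) (h1 : ∃ a ∈ G, a.1 = 1) : (E ∩ G).Nonempty := by
  obtain ⟨a, ha, ha0⟩ := h0
  obtain ⟨b, hb, hb1⟩ := h1
  obtain ⟨α, hα, rfl, rfl, hαG⟩ := exists_continuous_path_of_isPreconnected hGo hG ha hb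
  have hr : IsCompact (range fun s => (α s).2) := isCompact_range (by fun_prop)
  obtain ⟨A, hA⟩ := hr.bddBelow
  obtain ⟨B, hB⟩ := hr.bddAbove
  obtain ⟨c, hc, hcA⟩ := hdown A
  obtain ⟨d, hd, hdB⟩ := hup B
  obtain ⟨β, hβ, rfl, rfl, hβE⟩ := exists_continuous_path_of_isPreconnected hEo hE hc hd
  obtain ⟨s, t, hst⟩ := exists_eq_of_crossing
    (α := fun s => (((α s).1 : ℝ), (α s).2)) (β := fun s => (((β s).1 : ℝ), (β s).2))
    (by fun_prop) (by fun_prop)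
    (fun t => by simp only [ha0]; exact (β t).1.2.1)
    (fun t => by simp only [hb1]; exact (β t).1.2.2)
    (fun s => hcA.trans (hA ⟨s, rfl⟩)) (fun s => (hB ⟨s, rfl⟩).trans hdB)
  have h : α s = β t := Prod.ext (Subtype.ext (Prod.ext_iff.1 hst).1) (Prod.ext_iff.1 hst).2
  exact ⟨β t, hβE t, h ▸ hαG s⟩

/-- The preimage of an essential open set under `f × (z ↦ z ^ n)` is connected, provided that it
contains a connected set `L` spanning the annulus from one boundary circle to the other.
Any component of the preimage lifts to a set in the strip that covers a component of the lift of
`W`, hence is unbounded in both directions. So it crosses a lift of the component of `L`. -/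
theorem isPreconnected_preimage_of_isEssential {f : I → I} (hf : Continuous f)
    (hfo : IsOpenMap f) {n : ℕ} (hn : n ≠ 0) {W : Set (I × Circle)} (hWo : IsOpen W)
    (hess : IsEssential W) {L : Set (I × Circle)}
    (hL : IsPreconnected L) (hLW : L ⊆ Prod.map f (· ^ n) ⁻¹' W)
    (hspan : Prod.fst '' L = univ) :
    IsPreconnected (Prod.map f (· ^ n) ⁻¹' W : Set (I × Circle)) := by
  set F : I × Circle → I × Circle := Prod.map f (· ^ n) with hF
  have hFc : Continuous F := hf.prodMap (continuous_pow n)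
  have hn' : (n : ℝ) ≠ 0 := by exact_mod_cast hn
  -- The lift of `F` to the strip: it scales the second coordinate by `n`, so it is open and proper.
  let e : ℝ ≃ₜ ℝ := Homeomorph.mulLeft₀ (n : ℝ) hn'
  let φ : I × ℝ → I × ℝ := Prod.map f e
  have hφ : Continuous φ := hf.prodMap e.continuous
  have hφo : IsOpenMap φ := hfo.prodMap e.isOpenMap
  have hφc : IsClosedMap φ := (hf.isProperMap.prodMap e.isProperMap).isClosedMap
  have hcomm : ∀ a, annulusCover (φ a) = F (annulusCover a) := fun a =>
    Prod.ext rfl (Circle.exp_natCast_mul a.2 n)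
  obtain ⟨l, hl, hl0⟩ : (0 : I) ∈ Prod.fst '' L := hspan ▸ mem_univ _
  obtain ⟨l', hl', hl1⟩ : (1 : I) ∈ Prod.fst '' L := hspan ▸ mem_univ _
  set C := connectedComponentIn (F ⁻¹' W) l with hC
  have hCo : IsOpen C := (hWo.preimage hFc).connectedComponentIn
  have hCc : IsPreconnected C := isPreconnected_connectedComponentIn
  have hLC : L ⊆ C := hL.subset_connectedComponentIn hl hLW
  obtain ⟨g, hg⟩ := annulusCover_surjective l
  have hgC : annulusCover g ∈ C := hg ▸ hLC hl
  have himg := annulusCover_image_connectedComponentIn hCo hCc hgC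
  have hspanG : ∀ c ∈ C, ∃ a ∈ connectedComponentIn (annulusCover ⁻¹' C) g, a.1 = c.1 := by
    intro c hc
    rw [← himg] at hc
    obtain ⟨a, ha, rfl⟩ := hc
    exact ⟨a, ha, rfl⟩
  suffices F ⁻¹' W ⊆ C from (this.antisymm (connectedComponentIn_subset _ _)) ▸ hCc
  intro y hy
  obtain ⟨x, rfl⟩ := annulusCover_surjective y
  have hx : annulusCover (φ x) ∈ W := by rw [hcomm]; exact hy
  set D := connectedComponentIn (annulusCover ⁻¹' W) (φ x) with hD
  have hDo : IsOpen D := (hWo.preimage continuous_annulusCover).connectedComponentIn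
  have hxD : φ x ∈ D := mem_connectedComponentIn hx
  set E := connectedComponentIn (φ ⁻¹' D) x with hE
  have hED : φ '' E = D := image_connectedComponentIn_of_isOpenMap_of_isClosedMap hφ hφo hφc hDo
    isPreconnected_connectedComponentIn hxD
  have hφ2 : ∀ a, (φ a).2 = n * a.2 := fun a => rfl
  have hnpos : (0 : ℝ) < n := by exact_mod_cast Nat.pos_of_ne_zero hn
  obtain ⟨z, hzE, hzG⟩ := inter_nonempty_of_spanning_of_unbounded
    (E := E) (G := connectedComponentIn (annulusCover ⁻¹' C) g)
    (hDo.preimage hφ).connectedComponentIn isPreconnected_connectedComponentIn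
    (hCo.preimage continuous_annulusCover).connectedComponentIn
    isPreconnected_connectedComponentIn
    (fun R => by
      obtain ⟨d, hd, hdR⟩ := (hess (φ x) hx (n * R)).1
      rw [← hD, ← hED] at hd
      obtain ⟨a, ha, rfl⟩ := hd
      exact ⟨a, ha, le_of_mul_le_mul_left (hφ2 a ▸ hdR) hnpos⟩)
    (fun R => by
      obtain ⟨d, hd, hdR⟩ := (hess (φ x) hx (n * R)).2
      rw [← hD, ← hED] at hd
      obtain ⟨a, ha, rfl⟩ := hd
      exact ⟨a, ha, le_of_mul_le_mul_left (hφ2 a ▸ hdR) hnpos⟩)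
    (hl0 ▸ hspanG l (hLC hl)) (hl1 ▸ hspanG l' (hLC hl'))
  have hzC : annulusCover z ∈ C := connectedComponentIn_subset (annulusCover ⁻¹' C) g hzG
  have hEF : annulusCover '' E ⊆ F ⁻¹' W := by
    rintro _ ⟨a, ha, rfl⟩
    have h1 : φ a ∈ D := hED ▸ mem_image_of_mem φ ha
    have h2 : annulusCover (φ a) ∈ W := connectedComponentIn_subset (annulusCover ⁻¹' W) _ h1
    rwa [hcomm] at h2
  rw [hC, connectedComponentIn_eq hzC]
  exact (isPreconnected_connectedComponentIn.image _
    continuous_annulusCover.continuousOn).subset_connectedComponentIn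
    (mem_image_of_mem _ hzE) hEF (mem_image_of_mem _ (mem_connectedComponentIn hxD))

/-! ### Compactness arguments in inverse limits -/

theorem disjoint_image_of_le {Z Y : Type*} {P : ℕ → Z → Y}
    (hP : ∀ i a b, P (i + 1) a = P (i + 1) b → P i a = P i b) {A B : Set Z} {i j : ℕ}
    (hij : i ≤ j) (h : Disjoint (P i '' A) (P i '' B)) : Disjoint (P j '' A) (P j '' B) := by
  induction j, hij using Nat.le_induction with
  | base => exact h
  | succ j _ ih =>
    rw [Set.disjoint_left] at ih ⊢
    rintro _ ⟨a, ha, rfl⟩ ⟨b, hb, hab⟩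
    exact ih ⟨a, ha, rfl⟩ ⟨b, hb, hP _ _ _ hab⟩

/-- Disjoint closed subsets of a compact inverse limit are already disjoint at some stage. -/
theorem exists_disjoint_image {Z Y : Type*} [TopologicalSpace Z] [CompactSpace Z]
    [TopologicalSpace Y] [T2Space Y] {P : ℕ → Z → Y} (hPc : ∀ i, Continuous (P i))
    (hP : ∀ i a b, P (i + 1) a = P (i + 1) b → P i a = P i b)
    (hinj : ∀ a b, (∀ i, P i a = P i b) → a = b) {A B : Set Z} (hA : IsClosed A)
    (hB : IsClosed B) (hAB : Disjoint A B) : ∃ i, Disjoint (P i '' A) (P i '' B) := by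
  by_contra! h
  let T : ℕ → Set (Z × Z) := fun i => A ×ˢ B ∩ {z | P i z.1 = P i z.2}
  have hT : ∀ i, IsClosed (T i) := fun i => (hA.prod hB).inter
    (isClosed_eq ((hPc i).comp continuous_fst) ((hPc i).comp continuous_snd))
  obtain ⟨⟨a, b⟩, hab⟩ := IsCompact.nonempty_iInter_of_sequence_nonempty_isCompact_isClosed T
    (fun i z hz => ⟨hz.1, hP _ _ _ hz.2⟩)
    (fun i => by
      obtain ⟨_, ⟨a, ha, rfl⟩, b, hb, hab⟩ := Set.not_disjoint_iff.1 (h i)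
      exact ⟨(a, b), ⟨ha, hb⟩, hab.symm⟩)
    (hT 0).isCompact hT
  rw [mem_iInter] at hab
  have := hinj a b fun i => (hab i).2
  subst this
  exact Set.disjoint_left.1 hAB (hab 0).1.1 (hab 0).1.2

theorem exists_isOpen_preimage_subset {Z Y : Type*} [TopologicalSpace Z] [CompactSpace Z]
    [TopologicalSpace Y] [T2Space Y] {P : ℕ → Z → Y} (hPc : ∀ i, Continuous (P i))
    (hP : ∀ i a b, P (i + 1) a = P (i + 1) b → P i a = P i b)
    (hinj : ∀ a b, (∀ i, P i a = P i b) → a = b) {M U : Set Z} (hM : IsClosed M)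
    (hU : IsOpen U) (hMU : M ⊆ U) :
    ∃ i, ∃ W : Set Y, IsOpen W ∧ P i '' M ⊆ W ∧ P i ⁻¹' W ⊆ U := by
  obtain ⟨i, hi⟩ := exists_disjoint_image hPc hP hinj hM hU.isClosed_compl
    (disjoint_compl_right_iff_subset.2 hMU)
  refine ⟨i, (P i '' Uᶜ)ᶜ, ((hPc i).isClosedMap _ hU.isClosed_compl).isOpen_compl,
    hi.subset_compl_right, fun z hz => ?_⟩
  by_contra hzU
  exact hz ⟨z, hzU, rfl⟩

/-- A closed subset of a compact inverse limit is connected if its images at all late stages are: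
a separation would be visible at some stage. -/
theorem isPreconnected_of_forall_image {Z Y : Type*} [TopologicalSpace Z] [CompactSpace Z]
    [TopologicalSpace Y] [T2Space Y] {P : ℕ → Z → Y} (hPc : ∀ i, Continuous (P i))
    (hP : ∀ i a b, P (i + 1) a = P (i + 1) b → P i a = P i b)
    (hinj : ∀ a b, (∀ i, P i a = P i b) → a = b) {N : Set Z} (hN : IsClosed N) {i : ℕ}
    (h : ∀ j, i ≤ j → IsPreconnected (P j '' N)) : IsPreconnected N := by
  rw [isPreconnected_iff_subset_of_fully_disjoint_closed hN]
  intro u v hu hv huv hd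
  by_contra! hne
  obtain ⟨⟨a, ha, hau⟩, b, hb, hbv⟩ := hne.imp not_subset.1 not_subset.1
  obtain ⟨k, hk⟩ := exists_disjoint_image hPc hP hinj (hN.inter hu) (hN.inter hv)
    (hd.mono inter_subset_right inter_subset_right)
  replace hk := disjoint_image_of_le hP (le_max_right i k) hk
  have hcl := fun {s} => (hPc (max i k)).isClosedMap s
  obtain ⟨y, -, hyu, hyv⟩ := isPreconnected_closed_iff.1 (h _ (le_max_left i k)) _ _
    (hcl (hN.inter hu)) (hcl (hN.inter hv))
    (by rw [← image_union, ← inter_union_distrib_left, inter_eq_left.2 huv])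
    ⟨_, ⟨b, hb, rfl⟩, ⟨b, ⟨hb, (huv hb).resolve_right hbv⟩, rfl⟩⟩
    ⟨_, ⟨a, ha, rfl⟩, ⟨a, ⟨ha, (huv ha).resolve_left hau⟩, rfl⟩⟩
  exact Set.disjoint_left.1 hk hyu hyv

/-! ### Inverse limits of intervals and circles -/

/-- The coordinate maps of an inverse limit with surjective bonding maps are surjective. -/
theorem InverseLimit.exists_apply_eq {Y : Type*} {f : ℕ → Y → Y}
    (hf : ∀ i, Function.Surjective (f i)) (i : ℕ) (x : Y) :
    ∃ y : InverseLimit (fun _ => Y) f, y.1 i = x := by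
  induction i generalizing f with
  | zero =>
    let y : ℕ → Y := fun k => Nat.rec x (fun k z => Function.surjInv (hf k) z) k
    exact ⟨⟨y, fun k => Function.surjInv_eq (hf k) (y k)⟩, rfl⟩
  | succ i ih =>
    obtain ⟨y, rfl⟩ := ih fun k => hf (k + 1)
    refine ⟨⟨fun k => Nat.casesOn k (f 0 (y.1 0)) y.1, fun k => ?_⟩, rfl⟩
    cases k with
    | zero => rfl
    | succ k => exact y.2 k

theorem InverseLimit.compactSpace {Y : Type*} [TopologicalSpace Y] [CompactSpace Y] [T2Space Y]
    {f : ℕ → Y → Y} (hf : ∀ i, Continuous (f i)) :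
    CompactSpace (InverseLimit (fun _ => Y) f) := by
  have hclosed : IsClosed {x : ℕ → Y | ∀ i, f i (x (i + 1)) = x i} := by
    simp only [ofPred_forall]
    exact isClosed_iInter fun i =>
      isClosed_eq ((hf i).comp (continuous_apply _)) (continuous_apply _)
  exact isCompact_iff_compactSpace.1 hclosed.isCompact

/-- Coordinate maps `p i : K → Y` which are continuous, compatible with the bonding maps `f i`,
surjective, and jointly injective. If `K` is compact and `Y` Hausdorff, they identify `K` with the
inverse limit of `f`. -/
structure IsInverseLimitPresentation {K Y : Type*} [TopologicalSpace K] [TopologicalSpace Y]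
    (f : ℕ → Y → Y) (p : ℕ → K → Y) : Prop where
  continuous : ∀ i, Continuous (p i)
  bonding : ∀ i x, f i (p (i + 1) x) = p i x
  surjective : ∀ i, Function.Surjective (p i)
  injective : ∀ a b, (∀ i, p i a = p i b) → a = b

theorem exists_isInverseLimitPresentation {K Y : Type*} [TopologicalSpace K] [TopologicalSpace Y]
    [CompactSpace Y] [T2Space Y] {f : ℕ → Y → Y} (hf : ∀ i, Continuous (f i))
    (hfs : ∀ i, Function.Surjective (f i)) (e : K ≃ₜ InverseLimit (fun _ => Y) f) :
    CompactSpace K ∧ T2Space K ∧ ∃ p, IsInverseLimitPresentation (K := K) f p := by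
  have := InverseLimit.compactSpace hf
  have : T2Space (InverseLimit (fun _ => Y) f) :=
    inferInstanceAs (T2Space {x : ℕ → Y // ∀ i, f i (x (i + 1)) = x i})
  refine ⟨e.symm.compactSpace, e.symm.t2Space, fun i x => (e x).1 i,
    fun i => (continuous_apply i).comp (continuous_subtype_val.comp e.continuous),
    fun i x => (e x).2 i, fun i y => ?_, fun a b h => e.injective (Subtype.ext (funext h))⟩
  obtain ⟨x, rfl⟩ := InverseLimit.exists_apply_eq hfs i y
  exact ⟨e.symm x, by simp⟩

theorem IsOpenMap.surjective_of_continuous {X Y : Type*} [TopologicalSpace X] [CompactSpace X]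
    [Nonempty X] [TopologicalSpace Y] [T2Space Y] [PreconnectedSpace Y] {f : X → Y}
    (hf : Continuous f) (hfo : IsOpenMap f) : Function.Surjective f :=
  range_eq_univ.1 (IsClopen.eq_univ ⟨hf.isClosedMap.isClosed_range, hfo.isOpen_range⟩
    (range_nonempty f))

theorem isOpenMap_circle_pow {n : ℕ} (hn : n ≠ 0) : IsOpenMap fun z : Circle => z ^ n :=
  have : NeZero n := ⟨hn⟩
  (Circle.isQuotientCoveringMap_npow n).isCoveringMap.isOpenMap

theorem circle_pow_surjective {n : ℕ} (hn : n ≠ 0) :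
    Function.Surjective fun z : Circle => z ^ n := by
  intro z
  obtain ⟨t, rfl⟩ := Circle.exp_surjective z
  refine ⟨Circle.exp (t / n), ?_⟩
  have : (n : ℝ) ≠ 0 := by exact_mod_cast hn
  simp only [← Circle.exp_natCast_mul]
  congr 1
  field_simp

/-- The bonding maps from stage `i + k` to stage `i` are a continuous open map of the interval and
a power map of the circle whose exponent grows beyond all bounds with `k`. -/
theorem exists_composite_bonding {K S : Type*} [TopologicalSpace K] [TopologicalSpace S]
    {f : ℕ → I → I} {n : ℕ → ℕ} (hf : ∀ i, Continuous (f i)) (hfo : ∀ i, IsOpenMap (f i))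
    (hn : ∀ i, 2 ≤ n i) {p : ℕ → K → I} (hp : IsInverseLimitPresentation f p)
    {q : ℕ → S → Circle} (hq : IsInverseLimitPresentation (fun i z => z ^ n i) q) (i k : ℕ) :
    ∃ (g : I → I) (N : ℕ), Continuous g ∧ IsOpenMap g ∧ k < N ∧
      (∀ x, g (p (i + k) x) = p i x) ∧ ∀ s, q (i + k) s ^ N = q i s := by
  induction k with
  | zero => exact ⟨id, 1, continuous_id, IsOpenMap.id, one_pos, fun _ => rfl, fun _ => pow_one _⟩
  | succ k ih =>
    obtain ⟨g, N, hg, hgo, hN, hgp, hNq⟩ := ih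
    refine ⟨g ∘ f (i + k), n (i + k) * N, hg.comp (hf _), hgo.comp (hfo _), ?_, fun x => ?_,
      fun s => ?_⟩
    · nlinarith [hn (i + k)]
    · rw [← hgp, ← hp.bonding (i + k)]; rfl
    · rw [← hNq, ← hq.bonding (i + k), pow_mul]; rfl

theorem prodHasFupcon_of_presentations {K S : Type*} [TopologicalSpace K] [TopologicalSpace S]
    [CompactSpace K] [T2Space K] [CompactSpace S] [T2Space S]
    {f : ℕ → I → I} {n : ℕ → ℕ} (hf : ∀ i, Continuous (f i)) (hfo : ∀ i, IsOpenMap (f i))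
    (hn : ∀ i, 2 ≤ n i) {p : ℕ → K → I} (hp : IsInverseLimitPresentation f p)
    {q : ℕ → S → Circle} (hq : IsInverseLimitPresentation (fun i z => z ^ n i) q) :
    ProdHasFupcon K S := by
  intro M hMc hM hMK hMS U hU hMU
  let P : ℕ → K × S → I × Circle := fun i => Prod.map (p i) (q i)
  have hPc : ∀ i, Continuous (P i) := fun i => (hp.continuous i).prodMap (hq.continuous i)
  have hPs : ∀ i, Function.Surjective (P i) := fun i =>
    (hp.surjective i).prodMap (hq.surjective i)
  have hP : ∀ i a b, P (i + 1) a = P (i + 1) b → P i a = P i b := fun i a b h =>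
    Prod.ext
      ((hp.bonding i a.1).symm.trans
        ((congrArg (f i) (Prod.ext_iff.1 h).1).trans (hp.bonding i b.1)))
      ((hq.bonding i a.2).symm.trans
        ((congrArg (· ^ n i) (Prod.ext_iff.1 h).2).trans (hq.bonding i b.2)))
  have hinj : ∀ a b, (∀ i, P i a = P i b) → a = b := fun a b h =>
    Prod.ext (hp.injective _ _ fun i => (Prod.ext_iff.1 (h i)).1)
      (hq.injective _ _ fun i => (Prod.ext_iff.1 (h i)).2)
  obtain ⟨i, W₀, hW₀o, hMW₀, hW₀U⟩ :=
    exists_isOpen_preimage_subset hPc hP hinj hMc.isClosed hU hMU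
  obtain ⟨m, hm⟩ := hM.nonempty
  -- A branch of the angle near `P i '' M` would make `q (i + k)` miss a point on `M` for large `k`.
  have hess : ∀ W, IsOpen W → IsPreconnected W → P i '' M ⊆ W → IsEssential W := by
    intro W hWo hW hMW
    by_contra hne
    obtain ⟨θ, hθ, hθW⟩ := exists_angle_of_not_isEssential hWo hW hne
    have hmaps : MapsTo (P i) M W := mapsTo_iff_image_subset.2 hMW
    obtain ⟨k, hk⟩ := Filter.eventually_atTop.1 <|
      eventually_image_ne_univ_of_pow_eq_exp hMc hM.isPreconnected
        (hθ.comp (hPc i).continuousOn hmaps)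
    obtain ⟨g, N, -, -, hN, -, hNq⟩ := exists_composite_bonding hf hfo hn hp hq i k
    refine hk N hN.le (fun z => q (i + k) z.2)
      ((hq.continuous _).comp continuous_snd).continuousOn
      (fun z hz => (hNq z.2).trans (hθW _ (hmaps hz)).symm) ?_
    rw [← image_image (q (i + k)) Prod.snd, hMS, image_univ, (hq.surjective _).range_eq]
  set W := connectedComponentIn W₀ (P i m) with hW
  have hWo : IsOpen W := hW₀o.connectedComponentIn
  have hWc : IsPreconnected W := isPreconnected_connectedComponentIn
  have hPM : IsPreconnected (P i '' M) := hM.isPreconnected.image _ (hPc i).continuousOn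
  have hMW : P i '' M ⊆ W := hPM.subset_connectedComponentIn (mem_image_of_mem _ hm) hMW₀
  have hmW : P i m ∈ W := hMW (mem_image_of_mem _ hm)
  refine ⟨P i ⁻¹' W, hWo.preimage (hPc i), ⟨⟨m, hmW⟩, ?_⟩, image_subset_iff.1 hMW,
    (preimage_mono (connectedComponentIn_subset _ _)).trans hW₀U⟩
  -- `P i ⁻¹' W` need not be closed. Two of its points are joined by the closed set
  -- `P i ⁻¹' closure W'` for a connected open `W'` with closure in `W`, to which the compactness
  -- argument applies.
  refine isPreconnected_of_forall_pair fun a ha b hb => ?_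
  obtain ⟨γ, hγ, hγ0, hγ1, hγW⟩ := exists_continuous_path_of_isPreconnected hWo hWc hmW ha
  obtain ⟨δ, hδ, hδ0, hδ1, hδW⟩ := exists_continuous_path_of_isPreconnected hWo hWc hmW hb
  have hJ : IsClosed (P i '' M ∪ range γ ∪ range δ) :=
    (((hPc i).isClosedMap _ hMc.isClosed).union (isCompact_range hγ).isClosed).union
      (isCompact_range hδ).isClosed
  obtain ⟨T, hTo, hJT, hTW⟩ := normal_exists_closure_subset hJ hWo
    (union_subset (union_subset hMW (range_subset_iff.2 hγW)) (range_subset_iff.2 hδW))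
  have hMT : P i '' M ⊆ T := (subset_union_left.trans subset_union_left).trans hJT
  set W' := connectedComponentIn T (P i m) with hW'
  have hW'o : IsOpen W' := hTo.connectedComponentIn
  have hW'c : IsPreconnected W' := isPreconnected_connectedComponentIn
  have hMW' : P i '' M ⊆ W' := hPM.subset_connectedComponentIn (mem_image_of_mem _ hm) hMT
  have haW' : P i a ∈ W' := (isPreconnected_range hγ).subset_connectedComponentIn ⟨0, hγ0⟩
    ((subset_union_right.trans subset_union_left).trans hJT) ⟨1, hγ1⟩
  have hbW' : P i b ∈ W' := (isPreconnected_range hδ).subset_connectedComponentIn ⟨0, hδ0⟩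
    (subset_union_right.trans hJT) ⟨1, hδ1⟩
  refine ⟨P i ⁻¹' closure W',
    preimage_mono ((closure_mono (connectedComponentIn_subset _ _)).trans hTW),
    subset_closure haW', subset_closure hbW', ?_⟩
  refine isPreconnected_of_forall_image hPc hP hinj (isClosed_closure.preimage (hPc i)) (i := i)
    fun j hij => ?_
  obtain ⟨k, rfl⟩ := Nat.exists_eq_add_of_le hij
  obtain ⟨g, N, hg, hgo, hN, hgp, hNq⟩ := exists_composite_bonding hf hfo hn hp hq i k
  have hN0 : N ≠ 0 := by omega
  have hPi : P i = Prod.map g (· ^ N) ∘ P (i + k) :=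
    funext fun z => Prod.ext (hgp z.1).symm (hNq z.2).symm
  rw [hPi, preimage_comp, image_preimage_eq _ (hPs _),
    (hgo.prodMap (isOpenMap_circle_pow hN0)).preimage_closure_eq_closure_preimage
      (hg.prodMap (continuous_pow N))]
  refine (isPreconnected_preimage_of_isEssential hg hgo hN0 hW'o (hess W' hW'o hW'c hMW')
    (hM.isPreconnected.image _ (hPc (i + k)).continuousOn) ?_ ?_).closure
  · rw [← image_subset_iff, ← image_comp, ← hPi]
    exact hMW'
  · rw [image_image]
    change (fun z : K × S => p (i + k) z.1) '' M = univ
    rw [← image_image (p (i + k)) Prod.fst, hMK, image_univ, (hp.surjective _).range_eq]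

theorem theorem2 (K S : Type*) [TopologicalSpace K] [TopologicalSpace S]
    (hK : IsKnasterContinuum K) (hS : IsSolenoid S) : ProdHasFupcon K S := by
  obtain ⟨f, hf, hfo, ⟨e⟩⟩ := hK
  obtain ⟨n, hn, ⟨e'⟩⟩ := hS
  have hn0 : ∀ i, n i ≠ 0 := fun i => by have := hn i; omega
  obtain ⟨_, _, p, hp⟩ := exists_isInverseLimitPresentation hf
    (fun i => (hfo i).surjective_of_continuous (hf i)) e
  obtain ⟨_, _, q, hq⟩ := exists_isInverseLimitPresentation
    (fun i => continuous_pow (n i)) (fun i => circle_pow_surjective (hn0 i)) e'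
  exact prodHasFupcon_of_presentations hf hfo hn hp hq
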